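/- Let $p$ be a prime, $q$ a power of $p$, $\omega=e^{2\pi i/p}$, and let $\mathrm{tr}$ be the trace from $\mathbb F_q$ to $\mathbb F_p$. The space $(\mathbb C^q)^{\otimes N}$ has the orthonormal basis $|x\rangle$, $x\in\mathbb F_q^N$. For $a,b\in\mathbb F_q^N$ let $X(a)|x\rangle=|x+a\rangle$ and $Z(b)|x\rangle=\omega^{\mathrm{tr}(b\cdot x)}|x\rangle$ (tensor products of the corresponding one-qudit operators). Put $\zeta=\omega$ if $p>2$ and $\zeta=i$ if $p=2$. The error group is $\mathcal P_N=\{\zeta^cX(a)Z(b): c\in\mathbb Z_{\ge 0},\ a,b\in\mathbb F_q^N\}$, and the weight of $\zeta^cX(a)Z(b)$ is the number of its tensor factors $X(a_i)Z(b_i)$ that are not the identity. For a nonzero subspace $Q$ of $(\mathbb C^q)^{\otimes N}$ let $\mathrm{Stab}(Q)$ be the set of $E\in\mathcal P_N$ with $Ev=v$ for all $v\in Q$; $Q$ is a stabilizer code if it is the set of all vectors fixed by $\mathrm{Stab}(Q)$. $Q$ detects $E$ if there is a scalar $t$ with $\langle u|E|v\rangle=t\langle u|v\rangle$ for all $u,v\in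 Q$. The minimum distance of $Q$ is the positive integer $\delta$ such that $Q$ detects all errors in $\mathcal P_N$ of weight less than $\delta$, but not all those of weight $\delta$. $Q$ is an $[[N,K,\delta]]_q$ code if moreover $\dim Q=q^K$. Let $\mathscr C\subseteq\mathbb F_q^n$ be a linear code of dimension $k\ge 1$ over $\mathbb F_q$, with dual $\mathscr C^\perp$ and minimum Hamming distance $d(\mathscr C)$, and let $\mathscr D\subseteq\mathbb F_{q^k}^m$ be a linear code of dimension $s\ge 1$ over $\mathbb F_{q^k}$. Let $\kappa$ be any $\mathbb F_p$-linear isomorphism from $\mathbb F_{q^k}$ onto the space of $\mathbb F_p$-linear maps $\mathscr C\to\mathbb F_p$, put $f_\lambda=\kappa(\lambda)$, $H=[\omega^{f_\lambda(c)}]_{\lambda\in\mathbb F_{q^k},\,c\in\mathscr C}$ and $$\phi_\lambda=\frac1{\sqrt{q^k}}\sum_{c\in\mathscr C}\omega^{f_\lambda(c)}|c\rangle,$$ and let $Q_H(\mathscr C,\mathscr D)\subseteq(\mathbb C^q)^{\otimes nm}$ be the span of the vectors $\phi_{\lambda_1}\otimes\cdots\otimes\phi_{\lambda_m}$, $(\lambda_1,\dots,\lambda_m)\in\mathscr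 D$. For $\Lambda=(\lambda_1,\dots,\lambda_m)\in\mathscr D$ let $F_\Lambda:\mathscr C^m\to\mathbb F_p$, $F_\Lambda(c_1,\dots,c_m)=\sum_i f_{\lambda_i}(c_i)$. For $\lambda\in\mathbb F_{q^k}$ let $\Theta(\lambda)\in\mathbb F_q^n/\mathscr C^\perp$ be the class of all $x\in\mathbb F_q^n$ with $f_\lambda(c)=\mathrm{tr}(c\cdot x)$ for all $c\in\mathscr C$, and let $$\mathscr D^\Theta=\bigcup_{(\lambda_1,\dots,\lambda_m)\in\mathscr D}\Theta(\lambda_1)\times\cdots\times\Theta(\lambda_m)\subseteq(\mathbb F_q^n)^m=\mathbb F_q^{nm}.$$ Then $Q_H(\mathscr C,\mathscr D)$ is a stabilizer code and an $[[nm,ks,\delta]]_q$ quantum code with $\delta=\min\{d(\mathscr C),\ell\}$, where $\ell$ is the least Hamming weight of a vector in $\mathscr D^\Theta\setminus(\mathscr C^\perp)^m$. Its stabilizer group $\mathcal S=\mathrm{Stab}(Q_H(\mathscr C,\mathscr D))$ consists exactly of the errors $X(c_1,\dots,c_m)Z(d_1,\dots,d_m)$ with $(c_1,\dots,c_m)\in\bigcap_{\Lambda\in\mathscr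 D}\ker F_\Lambda$ and $d_1,\dots,d_m\in\mathscr C^\perp$. The centralizer of $\mathcal S$ in $\mathcal P_{nm}$ consists exactly of the errors $\zeta^cX(u_1,\dots,u_m)Z(v_1,\dots,v_m)$ with $c\in\mathbb Z_{\ge 0}$, $u_1,\dots,u_m\in\mathscr C$ and $(v_1,\dots,v_m)\in\mathscr D^\Theta$. -/

import Mathlib

namespace QCode

noncomputable section

open scoped Matrix InnerProductSpace

/-! ### Classical codes -/

section Classical

variable {F : Type*} [Field F] {n m : ℕ}

/-- The dual code `C^⊥ = {u : u · c = 0 for all c ∈ C}`. -/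
def dualCode (C : Submodule F (Fin n → F)) : Submodule F (Fin n → F) where
  carrier := {u | ∀ c ∈ C, u ⬝ᵥ c = 0}
  add_mem' := by
    intro a b ha hb c hc
    simp [add_dotProduct, ha c hc, hb c hc]
  zero_mem' := by
    intro c _
    simp
  smul_mem' := by
    intro r a ha c hc
    simp [smul_dotProduct, ha c hc]

/-- The number `d` is the minimum (Hamming) distance of the code `C`. -/
def IsMinDist [DecidableEq F] (C : Submodule F (Fin n → F)) (d : ℕ) : Prop :=
  IsLeast {w | ∃ x ∈ C, ∃ y ∈ C, x ≠ y ∧ hammingDist x y = w} d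

/-- The word of length `mn` obtained by writing `m` words of length `n` next to each other;
its coordinates are indexed by (block, position in the block). -/
def concat {A : Type*} (x : Fin m → Fin n → A) : Fin m × Fin n → A := fun ij => x ij.1 ij.2

end Classical

/-! ### Systems of qudits -/

/-- The space `(ℂ^q)^{⊗ N}` of a system of qudits over `F = 𝔽_q` labelled by `ι` (`N = |ι|`), through
its orthonormal basis of the vectors `|x⟩`, `x ∈ F^ι`: the coordinate of a vector at `x` is its
coefficient at `|x⟩`. -/
abbrev QuditSpace (F ι : Type*) := EuclideanSpace ℂ (ι → F)

/-- The basis vector `|x⟩`. -/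
def ket {F ι : Type*} [DecidableEq F] [Fintype ι] (x : ι → F) : QuditSpace F ι :=
  EuclideanSpace.single x 1

/-- The tensor product `φ_1 ⊗ ... ⊗ φ_m` of states of `n` qudits:
its coefficient at `|x_1 ... x_m⟩` is the product of the coefficients of `φ_i` at `|x_i⟩`. -/
def tensorState {F : Type*} {n m : ℕ} (φ : Fin m → QuditSpace F (Fin n)) :
    QuditSpace F (Fin m × Fin n) :=
  WithLp.toLp 2 fun x => ∏ i, φ i fun j => x (i, j)

/-- Operators on `ℂ^q`, as matrices in the basis `|x⟩`, `x ∈ F`. -/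
abbrev QuditOp (F : Type*) := Matrix F F ℂ

/-- Operators on `(ℂ^q)^{⊗ ι}`, as matrices in the basis `|x⟩`, `x ∈ F^ι`. They act on the state
space by `Matrix.toEuclideanLin`. -/
abbrev SystemOp (F ι : Type*) := Matrix (ι → F) (ι → F) ℂ

/-- The tensor product of single-qudit operators. -/
def tensorOp {F ι : Type*} [Fintype ι] (M : ι → QuditOp F) : SystemOp F ι :=
  Matrix.of fun y x => ∏ i, M i (y i) (x i)

section Errors

variable (p : ℕ) [Fact p.Prime] {F ι : Type*} [Field F] [Fintype F] [DecidableEq F]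
  [Algebra (ZMod p) F] [Fintype ι] [DecidableEq ι]

/-- `X(a)|x⟩ = |x + a⟩` on one qudit. -/
def X₁ (a : F) : QuditOp F := Matrix.of fun y x => if y = x + a then 1 else 0

/-- `Z(b)|x⟩ = ω^{tr(bx)}|x⟩` on one qudit, where `ω = e^{2πi/p}` and `tr` is the trace from `𝔽_q` to
`𝔽_p`; here `ZMod.stdAddChar j = ω^j`. -/
def Z₁ (b : F) : QuditOp F :=
  Matrix.diagonal fun x => ZMod.stdAddChar (Algebra.trace (ZMod p) F (b * x))

/-- `X(a) = X(a_1) ⊗ ... ⊗ X(a_N)`. -/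
def X (a : ι → F) : SystemOp F ι := tensorOp fun i => X₁ (a i)

/-- `Z(b) = Z(b_1) ⊗ ... ⊗ Z(b_N)`. -/
def Z (b : ι → F) : SystemOp F ι := tensorOp fun i => Z₁ p (b i)

/-- The root of unity whose powers are the phases of the error group:
`e^{2πi/p}` for `p > 2` and the imaginary unit for `p = 2`. -/
def phase : ℂ := if p = 2 then Complex.I else Complex.exp (2 * Real.pi * Complex.I / p)

/-- The error `ζ^c X(a) Z(b)`, where `ζ = phase p`. -/
def error (c : ℕ) (a b : ι → F) : SystemOp F ι := phase p ^ c • (X a * Z p b)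

/-- The error group, as a set of operators. -/
def errorGroup : Set (SystemOp F ι) := {E | ∃ (c : ℕ) (a b : ι → F), E = error p c a b}

/-- The weight of `ζ^c X(a) Z(b)`: the number of its tensor factors `X(a_i) Z(b_i)` that are not the
identity. -/
def errorWeight (a b : ι → F) : ℕ := {i | X₁ (a i) * Z₁ p (b i) ≠ 1}.ncard

/-- The stabilizer group of `Q`: the errors that fix every vector of `Q`. -/
def stab (Q : Submodule ℂ (QuditSpace F ι)) : Set (SystemOp F ι) :=
  {E | E ∈ errorGroup p ∧ ∀ v ∈ Q, Matrix.toEuclideanLin E v = v}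

/-- The joint eigenspace for the eigenvalue `1` of a set of operators. -/
def fix (S : Set (SystemOp F ι)) : Submodule ℂ (QuditSpace F ι) where
  carrier := {v | ∀ E ∈ S, Matrix.toEuclideanLin E v = v}
  add_mem' := by
    intro v w hv hw E hE
    rw [map_add, hv E hE, hw E hE]
  zero_mem' := by
    intro E _
    exact map_zero _
  smul_mem' := by
    intro c v hv E hE
    rw [map_smul, hv E hE]

/-- The centralizer of `S` in the error group. -/
def centralizer (S : Set (SystemOp F ι)) : Set (SystemOp F ι) :=
  {E | E ∈ errorGroup p ∧ ∀ A ∈ S, E * A = A * E}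

/-- A quantum code (a nonzero subspace) `Q` is a stabilizer code if `Q = Fix(Stab(Q))`. -/
def IsStabilizerCode (Q : Submodule ℂ (QuditSpace F ι)) : Prop :=
  Q ≠ ⊥ ∧ Q = fix (stab p Q)

/-- `Q` detects `E` if `⟨u|E|v⟩ = t⟨u|v⟩` for all `u, v ∈ Q`, with a scalar `t` depending only on
`E`. -/
def Detects (Q : Submodule ℂ (QuditSpace F ι)) (E : SystemOp F ι) : Prop :=
  ∃ t : ℂ, ∀ u ∈ Q, ∀ v ∈ Q, ⟪u, Matrix.toEuclideanLin E v⟫_ℂ = t * ⟪u, v⟫_ℂ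

/-- `Q` has minimum distance `δ`: it detects every error of weight less than `δ`, and there is an
error of weight `δ` that it does not detect. -/
def HasMinDistance (Q : Submodule ℂ (QuditSpace F ι)) (δ : ℕ) : Prop :=
  0 < δ ∧
  (∀ (c : ℕ) (a b : ι → F), errorWeight p a b < δ → Detects Q (error p c a b)) ∧
  ∃ (c : ℕ) (a b : ι → F), errorWeight p a b = δ ∧ ¬ Detects Q (error p c a b)

/-- `Q` is an `[[N, K, δ]]_q` quantum code: it has length `N`, dimension `q^K` and minimum
distance `δ`. -/
structure IsQuantumCode (Q : Submodule ℂ (QuditSpace F ι)) (N K δ : ℕ) : Prop where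
  length : Fintype.card ι = N
  dim : Module.finrank ℂ Q = Fintype.card F ^ K
  minDistance : HasMinDistance p Q δ

end Errors

/-! ### The construction -/

section Construction

variable (p : ℕ) [Fact p.Prime] {F K : Type*} [Field F] [Fintype F] [DecidableEq F]
  [Algebra (ZMod p) F] [Field K] [Algebra (ZMod p) K] {n m : ℕ}

/-- The matrix `H = [ω^{f_λ(c)}]`, with rows indexed by `λ ∈ K = 𝔽_{q^k}` and columns indexed by the
codewords `c ∈ C`. -/
def matrixOf {C : Submodule F (Fin n → F)} (f : K → C → ZMod p) : Matrix K C ℂ :=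
  Matrix.of fun l c => ZMod.stdAddChar (f l c)

/-- `φ_λ = (1/√(q^k)) ∑_{c ∈ C} H_{λ,c} |c⟩`, where `k = dim C`. -/
def phi {C : Submodule F (Fin n → F)} (H : Matrix K C ℂ) (l : K) : QuditSpace F (Fin n) :=
  ((1 / Real.sqrt ((Fintype.card F : ℝ) ^ Module.finrank F C) : ℝ) : ℂ) •
    ∑ᶠ c : C, H l c • ket (c : Fin n → F)

/-- `Q_H(C, D)`: the span of the states `Φ_Λ = φ_{λ_1} ⊗ ... ⊗ φ_{λ_m}` for
`Λ = (λ_1, ..., λ_m) ∈ D`. -/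
def QH {C : Submodule F (Fin n → F)} (H : Matrix K C ℂ) (D : Submodule K (Fin m → K)) :
    Submodule ℂ (QuditSpace F (Fin m × Fin n)) :=
  Submodule.span ℂ {Φ | ∃ L ∈ D, Φ = tensorState fun i => phi H (L i)}

variable {p} {C : Submodule F (Fin n → F)} (κ : K ≃ₗ[ZMod p] (C →ₗ[ZMod p] ZMod p))

/-- `F_Λ(c_1, ..., c_m) = f_{λ_1}(c_1) + ... + f_{λ_m}(c_m)` on `C^m`, where `f_λ = κ(λ)`. -/
def FL (L : Fin m → K) : (Fin m → C) →ₗ[ZMod p] ZMod p :=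
  ∑ i, κ (L i) ∘ₗ LinearMap.proj i

/-- The class `Θ(λ)` in `𝔽_q^n / C^⊥`, as a subset of `𝔽_q^n`: it consists of the `x` with
`f_λ(c) = tr(c · x)` for all `c ∈ C`. -/
def Theta (l : K) : Set (Fin n → F) :=
  {x | ∀ c : C, κ l c = Algebra.trace (ZMod p) F ((c : Fin n → F) ⬝ᵥ x)}

/-- `D^Θ`, the union of the sets `Θ(λ_1) × ... × Θ(λ_m)` over `(λ_1, ..., λ_m) ∈ D`. -/
def DTheta (D : Submodule K (Fin m → K)) : Set (Fin m → Fin n → F) :=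
  {x | ∃ L ∈ D, ∀ i, x i ∈ Theta κ (L i)}

/-- The least weight of a vector in `D^Θ` outside `(C^⊥)^m` is `ℓ`; the weight is the Hamming
weight of the vector of length `mn`. -/
def IsLeastWeight (D : Submodule K (Fin m → K)) (l : ℕ) : Prop :=
  IsLeast {w | ∃ x ∈ DTheta κ D, (¬ ∀ i, x i ∈ dualCode C) ∧ hammingNorm (concat x) = w} l

end Construction

end

end QCode

namespace QCode

noncomputable section

open scoped Matrix InnerProductSpace Classical

set_option linter.unusedSectionVars false

section Words

variable (p : ℕ) [Fact p.Prime] {F ι : Type*} [Field F] [Fintype F]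
  [Algebra (ZMod p) F] [Fintype ι]

/-! ### The trace form on words -/

/-! Let `G` be `C^m` and `M` be `D^Θ`, both `𝔽_p`-spaces of words, with duals taken for `tr (x ·
y)`. For any `y` in `Θ(λ_1) × ... × Θ(λ_m)`, the state `Φ_Λ` is a nonzero multiple of `∑_{x ∈ G}
ω^{tr (x · y)} |x⟩`. Hence the code is `charCode G M` (`QH_eq_charCode`), and `G^⊥ = (C^⊥)^m ≤ M`.
The stabilizer properties use only this inclusion.

The error `X(a)Z(b)` with `a ∈ G` moves the label `y` to `y + b`, up to a scalar, and labels count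
only modulo `G^⊥`. So the stabilizer is `X(M^⊥)Z(G^⊥)`, and commuting with it means `a ∈ G`, `b ∈
M`. Its fixed vectors are supported on `G` and invariant under `M^⊥`; Fourier inversion over `M`
writes them in character states (`mem_charCode_of_fix`).

An error with `a ∉ G` or `b ∉ M` maps the code to an orthogonal space, hence is detected. Otherwise
weight below `d(C)` forces `a = 0`, and weight below `ℓ` forces `b ∈ G^⊥`, so the error is a scalar
on the code. Both bounds are attained by undetected errors; for `d(C)` this needs a minimum weight
word of `G` outside `M^⊥`, supplied by the `K`-linearity of `D` (`exists_singleBlock_not_mem`). -/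

/-- The form `(x, y) ↦ tr (x · y)` on `F^ι`, with values in the prime field. -/
def traceDot (F ι : Type*) [Field F] [Algebra (ZMod p) F] [Fintype ι] :
    LinearMap.BilinForm (ZMod p) (ι → F) :=
  LinearMap.mk₂ (ZMod p) (fun x y => Algebra.trace (ZMod p) F (x ⬝ᵥ y))
    (fun x x' y => by rw [add_dotProduct, map_add])
    (fun a x y => by rw [smul_dotProduct, map_smul])
    (fun x y y' => by rw [dotProduct_add, map_add])
    (fun a x y => by rw [dotProduct_smul, map_smul])

variable {p}

theorem traceDot_apply (x y : ι → F) :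
    traceDot p F ι x y = Algebra.trace (ZMod p) F (x ⬝ᵥ y) := rfl

theorem traceDot_comm (x y : ι → F) : traceDot p F ι x y = traceDot p F ι y x := by
  rw [traceDot_apply, traceDot_apply, dotProduct_comm]

theorem eq_zero_of_trace_mul_eq_zero {a : F}
    (h : ∀ b, Algebra.trace (ZMod p) F (b * a) = 0) : a = 0 := by
  have : FiniteDimensional (ZMod p) F := Module.Finite.of_finite
  exact (traceForm_nondegenerate (ZMod p) F).1 a fun b => by
    rw [Algebra.traceForm_apply, mul_comm]; exact h b

theorem eq_zero_of_traceDot_eq_zero {x : ι → F} (h : ∀ y, traceDot p F ι x y = 0) : x = 0 := by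
  funext i
  refine eq_zero_of_trace_mul_eq_zero (p := p) fun b => ?_
  have := h (Pi.single i b)
  rwa [traceDot_apply, dotProduct_single, mul_comm] at this

variable (p F ι) in
theorem traceDot_nondegenerate : (traceDot p F ι).Nondegenerate :=
  ⟨fun _ h => eq_zero_of_traceDot_eq_zero h,
    fun _ h => eq_zero_of_traceDot_eq_zero fun x => (traceDot_comm _ _).trans (h x)⟩

/-- The orthogonal complement of a space of words with respect to the trace form. -/
def traceDual (M : Submodule (ZMod p) (ι → F)) : Submodule (ZMod p) (ι → F) :=
  (traceDot p F ι).orthogonal M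

theorem mem_traceDual {M : Submodule (ZMod p) (ι → F)} {x : ι → F} :
    x ∈ traceDual M ↔ ∀ y ∈ M, traceDot p F ι x y = 0 :=
  forall₂_congr fun y _ => by rw [traceDot_comm x y]

theorem traceDual_traceDual (M : Submodule (ZMod p) (ι → F)) : traceDual (traceDual M) = M := by
  have : FiniteDimensional (ZMod p) (ι → F) := Module.Finite.of_finite
  exact LinearMap.BilinForm.orthogonal_orthogonal (traceDot_nondegenerate p F ι)
    (fun x y h => (traceDot_comm y x).trans h) M

theorem traceDual_anti {M N : Submodule (ZMod p) (ι → F)} (h : M ≤ N) :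
    traceDual N ≤ traceDual M :=
  fun _ hx => mem_traceDual.2 fun y hy => mem_traceDual.1 hx y (h hy)

theorem traceDual_le_of_traceDual_le {G M : Submodule (ZMod p) (ι → F)} (h : traceDual G ≤ M) :
    traceDual M ≤ G :=
  (traceDual_anti h).trans (traceDual_traceDual G).le

/-- Every functional on a space of words is given by the trace form. -/
theorem exists_traceDot_eq {M : Submodule (ZMod p) (ι → F)} (f : M →ₗ[ZMod p] ZMod p) :
    ∃ y : ι → F, ∀ x : M, f x = traceDot p F ι x y := by
  have : FiniteDimensional (ZMod p) (ι → F) := Module.Finite.of_finite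
  obtain ⟨g, hg⟩ := LinearMap.exists_extend f
  refine ⟨((traceDot p F ι).toDual (traceDot_nondegenerate p F ι)).symm g, fun x => ?_⟩
  rw [traceDot_comm, LinearMap.BilinForm.apply_toDual_symm_apply, ← hg]
  rfl

/-! ### Characters -/

theorem stdAddChar_eq_one_iff {a : ZMod p} : (ZMod.stdAddChar a : ℂ) = 1 ↔ a = 0 := by
  rw [← AddChar.map_zero_eq_one (ZMod.stdAddChar (N := p)), ZMod.injective_stdAddChar.eq_iff]

theorem conj_stdAddChar (a : ZMod p) :
    (starRingEnd ℂ) (ZMod.stdAddChar a : ℂ) = ZMod.stdAddChar (-a) := by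
  rw [AddChar.map_neg_eq_conj]

/-- Orthogonality of the characters of a space of words. -/
theorem sum_stdAddChar_traceDot [DecidableEq ι] (M : Submodule (ZMod p) (ι → F)) (z : ι → F) :
    ∑ y : ι → F, (if y ∈ M then (ZMod.stdAddChar (traceDot p F ι z y) : ℂ) else 0) =
      if z ∈ traceDual M then (Nat.card M : ℂ) else 0 := by
  rw [← Finset.sum_filter, ← Finset.sum_subtype_eq_sum_filter, Finset.subtype_univ]
  let ψ : AddChar M ℂ :=
    (ZMod.stdAddChar (N := p)).compAddMonoidHom
      ((traceDot p F ι z ∘ₗ M.subtype).toAddMonoidHom)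
  have hψ : ψ = 0 ↔ z ∈ traceDual M := by
    rw [mem_traceDual, AddChar.eq_zero_iff]
    exact ⟨fun h y hy => stdAddChar_eq_one_iff.1 (h ⟨y, hy⟩),
      fun h y => stdAddChar_eq_one_iff.2 (h y y.2)⟩
  have := AddChar.sum_eq_ite ψ
  simp only [hψ, ← Nat.card_eq_fintype_card] at this
  exact this

/-! ### Errors as operators on functions -/

theorem phase_ne_zero : phase p ≠ 0 := by
  unfold phase
  split
  · exact Complex.I_ne_zero
  · exact Complex.exp_ne_zero _

variable [DecidableEq F] [DecidableEq ι]

theorem X_apply (a x y : ι → F) : X a y x = if y = x + a then 1 else 0 := by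
  simp only [X, tensorOp, X₁, Matrix.of_apply, Finset.prod_ite_zero, Finset.prod_const_one]
  simp [funext_iff]

theorem Z_apply (b x y : ι → F) :
    Z p b y x = if y = x then (ZMod.stdAddChar (traceDot p F ι x b) : ℂ) else 0 := by
  simp only [Z, tensorOp, Z₁, Matrix.diagonal_apply, Matrix.of_apply, Finset.prod_ite_zero]
  by_cases h : y = x
  · subst h
    rw [if_pos rfl, if_pos fun _ _ => rfl, traceDot_apply, dotProduct, map_sum]
    simp only [mul_comm (y _)]
    exact (map_prod (ZMod.stdAddChar (N := p)).toMonoidHom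
      (fun i => Multiplicative.ofAdd (Algebra.trace (ZMod p) F (b i * y i))) _).symm
  · rw [if_neg h, if_neg]
    simpa [funext_iff] using h

theorem X_mul_Z_apply (a b x y : ι → F) :
    (X a * Z p b : SystemOp F ι) y x =
      if y = x + a then (ZMod.stdAddChar (traceDot p F ι x b) : ℂ) else 0 := by
  simp [Matrix.mul_apply, X_apply, Z_apply]

theorem toEuclideanLin_error (c : ℕ) (a b x : ι → F) (v : QuditSpace F ι) :
    Matrix.toEuclideanLin (error p c a b) v x =
      phase p ^ c * (ZMod.stdAddChar (traceDot p F ι (x - a) b) * v (x - a)) := by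
  have h : ∀ y, x = y + a ↔ y = x - a := fun y => by rw [eq_sub_iff_add_eq, eq_comm]
  rw [Matrix.toLpLin_apply]
  simp only [error, Matrix.mulVec, dotProduct, Matrix.smul_apply, X_mul_Z_apply, h, smul_eq_mul,
    mul_ite, mul_zero, ite_mul, zero_mul, Finset.sum_ite_eq', Finset.mem_univ, if_true, mul_assoc]

theorem X_mul_Z_eq_error (a b : ι → F) :
    (X a * Z p b : SystemOp F ι) = error p 0 a b := by
  simp [error]

/-- Moving `Z(b)` past `X(a')` costs `ω^{tr (a' · b)}`, so the two products are multiples of one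
nonzero operator and the phases cancel. -/
theorem error_commute_iff (c c' : ℕ) (a b a' b' : ι → F) :
    error p c a b * error p c' a' b' = error p c' a' b' * error p c a b ↔
      traceDot p F ι a' b = traceDot p F ι a b' := by
  have key : ∀ (a b a' b' : ι → F), (X a * Z p b) * (X a' * Z p b' : SystemOp F ι) =
      (ZMod.stdAddChar (traceDot p F ι a' b) : ℂ) • (X (a + a') * Z p (b + b')) := by
    intro a b a' b'
    ext y x
    rw [Matrix.mul_apply]
    simp only [X_mul_Z_apply, Matrix.smul_apply, smul_eq_mul]
    have : x + a' + a = x + (a + a') := by abel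
    simp only [mul_ite, mul_zero, Finset.sum_ite_eq', Finset.mem_univ, if_true, this,
      map_add, LinearMap.add_apply, AddChar.map_add_eq_mul, ite_mul, zero_mul]
    split_ifs <;> ring
  have hne : (X (a + a') * Z p (b + b') : SystemOp F ι) ≠ 0 := by
    intro h
    have := congrFun (congrFun h (a + a')) 0
    simp [X_mul_Z_apply] at this
  have hp : ∀ c, phase p ^ c ≠ 0 := fun c => pow_ne_zero _ phase_ne_zero
  simp only [error, smul_mul_smul_comm, key, add_comm a' a, add_comm b' b]
  rw [mul_comm (phase p ^ c'), smul_right_inj (mul_ne_zero (hp c) (hp c')),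
    (smul_left_injective ℂ hne).eq_iff, ZMod.injective_stdAddChar.eq_iff]

theorem errorWeight_eq (a b : ι → F) : errorWeight p a b = {i | a i ≠ 0 ∨ b i ≠ 0}.ncard := by
  unfold errorWeight
  congr 1
  ext i
  simp only [Set.mem_ofPred_eq, ← not_and_or, not_iff_not]
  constructor
  · intro h
    have h0 : ∀ x y : F, (if y = x + a i then
        (ZMod.stdAddChar (Algebra.trace (ZMod p) F (b i * x)) : ℂ) else 0) =
        (1 : Matrix F F ℂ) y x := by
      intro x y
      rw [← h]
      simp [X₁, Z₁, Matrix.mul_diagonal]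
    -- Column `0` of the identity gives `a i = 0`; the diagonal then gives `tr (b i * x) = 0` for
    -- all `x`.
    have ha : a i = 0 := by
      by_contra ha
      simpa [Matrix.one_apply, ha] using h0 0 (a i)
    refine ⟨ha, eq_zero_of_trace_mul_eq_zero (p := p) fun x => ?_⟩
    have := h0 x x
    rw [ha, add_zero, if_pos rfl, Matrix.one_apply_eq, stdAddChar_eq_one_iff] at this
    rwa [mul_comm]
  · rintro ⟨ha, hb⟩
    ext y x
    simp [X₁, Z₁, ha, hb, Matrix.one_apply]

theorem hammingNorm_le_errorWeight_left (a b : ι → F) : hammingNorm a ≤ errorWeight p a b := by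
  rw [errorWeight_eq, hammingNorm, ← Set.ncard_coe_finset]
  exact Set.ncard_le_ncard (fun i hi => Or.inl (by simpa using hi)) (Set.toFinite _)

theorem hammingNorm_le_errorWeight_right (a b : ι → F) : hammingNorm b ≤ errorWeight p a b := by
  rw [errorWeight_eq, hammingNorm, ← Set.ncard_coe_finset]
  exact Set.ncard_le_ncard (fun i hi => Or.inr (by simpa using hi)) (Set.toFinite _)

theorem errorWeight_zero_right (a : ι → F) : errorWeight p a 0 = hammingNorm a := by
  rw [errorWeight_eq, hammingNorm, ← Set.ncard_coe_finset]
  simp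

theorem errorWeight_zero_left (b : ι → F) : errorWeight p 0 b = hammingNorm b := by
  rw [errorWeight_eq, hammingNorm, ← Set.ncard_coe_finset]
  simp

end Words

section CharStates

variable {p : ℕ} [Fact p.Prime] {F ι : Type*} [Field F] [Fintype F]
  [Algebra (ZMod p) F] [Fintype ι] [DecidableEq F] [DecidableEq ι]

/-! ### Character states and the code they span -/

/-- The unnormalised state `∑_{x ∈ G} ω^{tr (x · y)} |x⟩`. -/
def charState (G : Submodule (ZMod p) (ι → F)) (y : ι → F) : QuditSpace F ι :=
  WithLp.toLp 2 fun x => if x ∈ G then ZMod.stdAddChar (traceDot p F ι x y) else 0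

/-- The span of the character states on `G` with labels in `M`. -/
def charCode (G M : Submodule (ZMod p) (ι → F)) : Submodule ℂ (QuditSpace F ι) :=
  Submodule.span ℂ (charState G '' M)

variable {G M : Submodule (ZMod p) (ι → F)}

theorem charState_apply (G : Submodule (ZMod p) (ι → F)) (x y : ι → F) :
    charState G y x = if x ∈ G then (ZMod.stdAddChar (traceDot p F ι x y) : ℂ) else 0 := rfl

theorem charState_mem {y : ι → F} (hy : y ∈ M) : charState G y ∈ charCode G M :=
  Submodule.subset_span ⟨y, hy, rfl⟩

theorem charState_eq_of_sub_mem {y y' : ι → F} (h : y - y' ∈ traceDual G) :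
    charState G y = charState G y' := by
  ext x
  simp only [charState_apply]
  split_ifs with hx
  · have := mem_traceDual.1 h x hx
    rw [traceDot_comm, map_sub, sub_eq_zero] at this
    rw [this]
  · rfl

/-- The summand is the character of `G` with label `y' - y`, so the sum is `|G|` or `0`. -/
theorem inner_charState (y y' : ι → F) :
    ⟪charState G y, charState G y'⟫_ℂ =
      if y' - y ∈ traceDual G then (Nat.card G : ℂ) else 0 := by
  rw [← sum_stdAddChar_traceDot, PiLp.inner_apply]
  refine Finset.sum_congr rfl fun x _ => ?_
  simp only [charState_apply]
  split_ifs
  · rw [RCLike.inner_apply, conj_stdAddChar, ← AddChar.map_add_eq_mul, traceDot_comm _ x, map_sub,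
      sub_eq_add_neg]
  · simp

theorem inner_charState_self_ne_zero (y : ι → F) :
    ⟪charState G y, charState G y⟫_ℂ ≠ 0 := by
  rw [inner_charState, sub_self, if_pos (zero_mem _)]
  exact_mod_cast Nat.card_pos.ne'

/-- `X(a)` only permutes the support `G` and contributes a scalar, while `Z(b)` translates the
label. -/
theorem toEuclideanLin_error_charState {a : ι → F} (ha : a ∈ G) (c : ℕ) (b y : ι → F) :
    Matrix.toEuclideanLin (error p c a b) (charState G y) =
      (phase p ^ c * ZMod.stdAddChar (-traceDot p F ι a (b + y))) • charState G (b + y) := by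
  ext x
  rw [toEuclideanLin_error, PiLp.smul_apply, smul_eq_mul, charState_apply, charState_apply,
    G.sub_mem_iff_left ha]
  split_ifs
  · rw [mul_assoc, ← AddChar.map_add_eq_mul, ← AddChar.map_add_eq_mul]
    congr 2
    simp only [map_sub, map_add, LinearMap.sub_apply]
    ring
  · simp

theorem toEuclideanLin_eq_of_mem_span {E : SystemOp F ι} {S : Set (QuditSpace F ι)}
    (h : ∀ v ∈ S, Matrix.toEuclideanLin E v = v) :
    ∀ v ∈ Submodule.span ℂ S, Matrix.toEuclideanLin E v = v := fun v hv => by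
  induction hv using Submodule.span_induction with
  | mem v hv => exact h v hv
  | zero => exact map_zero _
  | add v w _ _ hv hw => rw [map_add, hv, hw]
  | smul a v _ hv => rw [map_smul, hv]

/-- The stabilizer of the code spanned by character states. -/
theorem stab_charCode :
    stab p (charCode G M) =
      {E | ∃ c ∈ traceDual M, c ∈ G ∧ ∃ d ∈ traceDual G, E = X c * Z p d} := by
  ext E
  constructor
  · rintro ⟨⟨c, a, b, rfl⟩, hE⟩
    have h0 : ∀ x, phase p ^ c * ((ZMod.stdAddChar (traceDot p F ι (x - a) b) : ℂ) *
        charState G 0 (x - a)) = charState G 0 x := fun x => by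
      rw [← toEuclideanLin_error, hE _ (charState_mem (zero_mem M))]
    have hp : phase p ^ c ≠ 0 := pow_ne_zero _ phase_ne_zero
    -- The state with label `0` has coordinate `1` at `0`, which the error carries to `a`. The image
    -- is fixed, so `a ∈ G` and the phase is `1`.
    have ha' := h0 a
    simp only [sub_self, charState_apply, zero_mem, if_true, map_zero, LinearMap.zero_apply,
      AddChar.map_zero_eq_one, mul_one] at ha'
    have ha : a ∈ G := by
      by_contra ha
      exact hp (ha'.trans (if_neg ha))
    rw [if_pos ha] at ha'
    have hb : b ∈ traceDual G := mem_traceDual.2 fun x hx => by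
      have := h0 (x + a)
      simp only [add_sub_cancel_right, charState_apply, hx, G.add_mem hx ha, if_true, map_zero,
        AddChar.map_zero_eq_one, mul_one, ha', one_mul] at this
      rw [traceDot_comm]
      exact stdAddChar_eq_one_iff.1 this
    refine ⟨a, mem_traceDual.2 fun y hy => ?_, ha, b, hb, ?_⟩
    -- At the coordinate `a`, the state with label `y` compares its value `1` at `0` with `ω^{tr (a
    -- · y)}`.
    · have := congrArg (fun v : QuditSpace F ι => v a) (hE _ (charState_mem hy))
      simp only [toEuclideanLin_error, ha', sub_self, charState_apply, zero_mem, ha, if_true,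
        map_zero, LinearMap.zero_apply, AddChar.map_zero_eq_one, mul_one] at this
      exact stdAddChar_eq_one_iff.1 this.symm
    · rw [error, ha', one_smul]
  · rintro ⟨c, hc, hcG, d, hd, rfl⟩
    rw [X_mul_Z_eq_error]
    refine ⟨⟨0, c, d, rfl⟩, toEuclideanLin_eq_of_mem_span ?_⟩
    rintro _ ⟨y, hy, rfl⟩
    have h1 : traceDot p F ι c d = 0 := by rw [traceDot_comm]; exact mem_traceDual.1 hd c hcG
    rw [toEuclideanLin_error_charState hcG, map_add, mem_traceDual.1 hc y hy, h1,
      charState_eq_of_sub_mem (y := d + y) (y' := y) (by simpa using hd)]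
    simp

/-- Such a vector is a combination of indicators of cosets of `M^⊥` inside `G`, and each indicator
is a Fourier sum of character states over `M`. -/
theorem mem_charCode_of_fix (h : traceDual G ≤ M) {v : QuditSpace F ι}
    (hZ : ∀ x, x ∉ G → v x = 0) (hX : ∀ c ∈ traceDual M, ∀ x, v (x - c) = v x) :
    v ∈ charCode G M := by
  let N := traceDual M
  have hNG : N ≤ G := traceDual_le_of_traceDual_le h
  have hind : ∀ x ∈ G, (WithLp.toLp 2 fun z => if z - x ∈ N then (1 : ℂ) else 0 :
      QuditSpace F ι) ∈ charCode G M := by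
    intro x hx
    have hM : (Nat.card M : ℂ) ≠ 0 := by exact_mod_cast Nat.card_pos.ne'
    rw [← (charCode G M).smul_mem_iff hM]
    have : ((Nat.card M : ℂ) • (WithLp.toLp 2 fun z => if z - x ∈ N then (1 : ℂ) else 0 :
        QuditSpace F ι)) = ∑ y : ι → F,
        (if y ∈ M then (ZMod.stdAddChar (-traceDot p F ι x y) : ℂ) else 0) • charState G y := by
      ext z
      simp only [PiLp.smul_apply, WithLp.ofLp_sum, Finset.sum_apply, WithLp.ofLp_smul,
        Pi.smul_apply, smul_eq_mul, charState_apply, mul_ite, mul_one, mul_zero]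
      have hsum := sum_stdAddChar_traceDot M (z - x)
      by_cases hzG : z ∈ G
      · simp only [hzG, if_true]
        refine hsum.symm.trans ?_
        refine Finset.sum_congr rfl fun y _ => ?_
        split_ifs
        · rw [← AddChar.map_add_eq_mul, map_sub, LinearMap.sub_apply, neg_add_eq_sub]
        · simp
      -- Outside `G` both sides vanish: the coset of `x ∈ G` stays in `G` because `N ≤ G`.
      · have hz : z - x ∉ N := fun hz => hzG ((G.sub_mem_iff_left hx).1 (hNG hz))
        simp [hz, hzG]
    rw [this]
    refine Submodule.sum_mem _ fun y _ => ?_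
    split_ifs with hy
    · exact Submodule.smul_mem _ _ (charState_mem hy)
    · simp
  have hN : (Nat.card N : ℂ) ≠ 0 := by exact_mod_cast Nat.card_pos.ne'
  rw [← (charCode G M).smul_mem_iff hN]
  -- Each coordinate is counted once for every element of its coset, whence the factor `|N|`.
  have : (Nat.card N : ℂ) • v = ∑ x : ι → F,
      v x • (WithLp.toLp 2 fun z => if z - x ∈ N then (1 : ℂ) else 0 : QuditSpace F ι) := by
    ext z
    simp only [PiLp.smul_apply, WithLp.ofLp_sum, Finset.sum_apply, WithLp.ofLp_smul,
      Pi.smul_apply, smul_eq_mul, mul_ite, mul_one, mul_zero]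
    rw [← (Equiv.subLeft z).sum_comp]
    simp only [Equiv.subLeft_apply, sub_sub_cancel]
    have : ∀ x, (if x ∈ N then v (z - x) else 0) = if x ∈ N then v z else 0 := fun x => by
      split_ifs with hx
      · exact hX x hx z
      · rfl
    rw [Finset.sum_congr rfl fun x _ => this x, ← Finset.sum_filter, Finset.sum_const,
      nsmul_eq_mul, Nat.card_eq_fintype_card, Fintype.card_subtype]
  rw [this]
  refine Submodule.sum_mem _ fun x _ => ?_
  by_cases hx : x ∈ G
  · exact Submodule.smul_mem _ _ (hind x hx)
  · simp [hZ x hx]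

theorem charCode_ne_bot : charCode G M ≠ ⊥ := fun h => by
  have h0 : charState G 0 ∈ charCode G M := charState_mem (zero_mem M)
  rw [h, Submodule.mem_bot] at h0
  exact inner_charState_self_ne_zero (G := G) 0 (by rw [h0, inner_zero_left])

theorem isStabilizerCode_charCode (h : traceDual G ≤ M) : IsStabilizerCode p (charCode G M) := by
  refine ⟨charCode_ne_bot, le_antisymm (fun v hv E hE => hE.2 v hv) fun v hv => ?_⟩
  have hNG := traceDual_le_of_traceDual_le h
  have hv' : ∀ c ∈ traceDual M, ∀ d ∈ traceDual G, ∀ x,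
      (ZMod.stdAddChar (traceDot p F ι (x - c) d) : ℂ) * v (x - c) = v x := by
    intro c hc d hd x
    have := hv (X c * Z p d) (by rw [stab_charCode]; exact ⟨c, hc, hNG hc, d, hd, rfl⟩)
    rw [X_mul_Z_eq_error] at this
    simpa [toEuclideanLin_error] using congrArg (fun w : QuditSpace F ι => w x) this
  refine mem_charCode_of_fix h (fun x hx => ?_) fun c hc x => ?_
  -- By biduality a word outside `G` is seen by some `d ∈ G^⊥`; `Z(d)` multiplies its coordinate by
  -- a nontrivial root of unity.
  · rw [← traceDual_traceDual G, mem_traceDual] at hx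
    push Not at hx
    obtain ⟨d, hd, hne⟩ := hx
    have := hv' 0 (zero_mem _) d hd x
    rw [sub_zero] at this
    by_contra h0
    exact hne (stdAddChar_eq_one_iff.1 ((mul_eq_right₀ h0).1 this))
  · simpa using hv' c hc 0 (zero_mem _) x

/-- The centralizer of the stabilizer of the code spanned by character states. -/
theorem centralizer_stab_charCode (h : traceDual G ≤ M) :
    centralizer p (stab p (charCode G M)) =
      {E | ∃ (c : ℕ), ∃ u ∈ G, ∃ v ∈ M, E = error p c u v} := by
  have hNG := traceDual_le_of_traceDual_le h
  rw [stab_charCode]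
  ext E
  constructor
  · rintro ⟨⟨c, a, b, rfl⟩, hE⟩
    refine ⟨c, a, ?_, b, ?_, rfl⟩
    · rw [← traceDual_traceDual G, mem_traceDual]
      intro d hd
      have := hE _ ⟨0, zero_mem _, zero_mem _, d, hd, rfl⟩
      rw [X_mul_Z_eq_error, error_commute_iff, map_zero, LinearMap.zero_apply] at this
      exact this.symm
    · rw [← traceDual_traceDual M, mem_traceDual]
      intro d hd
      have := hE _ ⟨d, hd, hNG hd, 0, zero_mem _, rfl⟩
      rw [X_mul_Z_eq_error, error_commute_iff, map_zero] at this
      rw [traceDot_comm, this]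
  · rintro ⟨c, u, hu, v, hv, rfl⟩
    refine ⟨⟨c, u, v, rfl⟩, ?_⟩
    rintro _ ⟨a, ha, -, b, hb, rfl⟩
    rw [X_mul_Z_eq_error, error_commute_iff, mem_traceDual.1 ha v hv, traceDot_comm,
      mem_traceDual.1 hb u hu]

/-- The states with labels from pairwise different classes modulo the dual are independent. -/
theorem linearIndependent_charState {κ : Type*} (y : κ → ι → F)
    (hy : ∀ i j, y i - y j ∈ traceDual G → i = j) :
    LinearIndependent ℂ fun i => charState G (y i) := by
  refine linearIndependent_of_ne_zero_of_inner_eq_zero (𝕜 := ℂ) (fun i h => ?_) fun i j hij => ?_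
  · exact inner_charState_self_ne_zero (G := G) (y i) (by rw [h, inner_zero_left])
  · show ⟪charState G (y i), charState G (y j)⟫_ℂ = 0
    rw [inner_charState, if_neg fun h => hij (hy j i h).symm]

/-! ### Detection of errors and minimum distance -/

theorem detects_span {S : Set (QuditSpace F ι)} {E : SystemOp F ι} (t : ℂ)
    (h : ∀ u ∈ S, ∀ v ∈ S, ⟪u, Matrix.toEuclideanLin E v⟫_ℂ = t * ⟪u, v⟫_ℂ) :
    Detects (Submodule.span ℂ S) E := by
  refine ⟨t, fun u hu v hv => ?_⟩
  induction hu, hv using Submodule.span_induction₂ with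
  | mem_mem u v hu hv => exact h u hu v hv
  | zero_left v hv => simp
  | zero_right u hu => simp
  | add_left x y z _ _ _ h1 h2 => rw [inner_add_left, inner_add_left, h1, h2, mul_add]
  | add_right x y z _ _ _ h1 h2 => rw [map_add, inner_add_right, inner_add_right, h1, h2, mul_add]
  | smul_left r x y _ _ h => rw [inner_smul_left, inner_smul_left, h]; ring
  | smul_right r x y _ _ h => rw [map_smul, inner_smul_right, inner_smul_right, h]; ring

/-- The support moves to a coset of `G` disjoint from `G`. -/
theorem detects_of_not_mem_left {a : ι → F} (ha : a ∉ G) (c : ℕ) (b : ι → F) :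
    Detects (charCode G M) (error p c a b) := by
  refine detects_span 0 ?_
  rintro _ ⟨y, -, rfl⟩ _ ⟨y', -, rfl⟩
  rw [zero_mul, PiLp.inner_apply]
  refine Finset.sum_eq_zero fun x _ => ?_
  rw [toEuclideanLin_error, charState_apply, charState_apply]
  by_cases hx : x ∈ G
  · rw [if_neg fun h => ha ((G.sub_mem_iff_right hx).1 h)]
    simp
  · simp [hx]

/-- Labels move from `M` to `b + M`, and no class modulo `G^⊥ ≤ M` meets both. -/
theorem detects_of_not_mem_right {a b : ι → F} (ha : a ∈ G) (h : traceDual G ≤ M) (hb : b ∉ M)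
    (c : ℕ) : Detects (charCode G M) (error p c a b) := by
  refine detects_span 0 ?_
  rintro _ ⟨y, hy, rfl⟩ _ ⟨y', hy', rfl⟩
  rw [zero_mul, toEuclideanLin_error_charState ha, inner_smul_right, inner_charState, if_neg,
    mul_zero]
  intro hmem
  have h1 := M.add_mem (h hmem) (M.sub_mem hy hy')
  exact hb (by convert h1 using 1; abel)

theorem detects_of_mem_traceDual {b : ι → F} (hb : b ∈ traceDual G) (c : ℕ) :
    Detects (charCode G M) (error p c 0 b) := by
  refine detects_span (phase p ^ c) ?_
  rintro _ ⟨y, -, rfl⟩ _ ⟨y', -, rfl⟩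
  rw [toEuclideanLin_error_charState (zero_mem G), inner_smul_right,
    charState_eq_of_sub_mem (y := b + y') (y' := y') (by simpa using hb)]
  simp

/-- `X(a)` is diagonal on the character states, with eigenvalues `ω^{-tr (a · y)}`. Detection would
make them all equal to the value `1` at `y = 0`. -/
theorem not_detects_X {a : ι → F} (ha : a ∈ G) (haM : a ∉ traceDual M) :
    ¬ Detects (charCode G M) (error p 0 a 0) := by
  rintro ⟨t, ht⟩
  rw [mem_traceDual] at haM
  push Not at haM
  obtain ⟨y, hy, hne⟩ := haM
  have key : ∀ y ∈ M, (ZMod.stdAddChar (-traceDot p F ι a y) : ℂ) = t := fun y hy => by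
    have := ht _ (charState_mem hy) _ (charState_mem hy)
    rw [toEuclideanLin_error_charState ha, inner_smul_right, zero_add, pow_zero, one_mul] at this
    exact mul_right_cancel₀ (inner_charState_self_ne_zero y) this
  have h0 := key 0 (zero_mem M)
  rw [map_zero, neg_zero, AddChar.map_zero_eq_one] at h0
  exact hne (neg_eq_zero.1 (stdAddChar_eq_one_iff.1 ((key y hy).trans h0.symm)))

/-- `Z(b)` turns the state with label `0` into the orthogonal state with label `b`, so the matrix
entry between them is nonzero. -/
theorem not_detects_Z {b : ι → F} (hb : b ∈ M) (hbG : b ∉ traceDual G) :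
    ¬ Detects (charCode G M) (error p 0 0 b) := by
  rintro ⟨t, ht⟩
  have := ht _ (charState_mem hb) _ (charState_mem (zero_mem M))
  rw [toEuclideanLin_error_charState (zero_mem G), inner_smul_right, add_zero,
    inner_charState b 0, if_neg (by simpa using hbG)] at this
  simp only [pow_zero, map_zero, LinearMap.zero_apply, neg_zero, AddChar.map_zero_eq_one, one_mul,
    mul_zero] at this
  exact inner_charState_self_ne_zero b this

/-- The minimum distance of the code spanned by character states. -/
theorem hasMinDistance_charCode (h : traceDual G ≤ M) {d l : ℕ}
    (hd : ∀ x ∈ G, x ≠ 0 → d ≤ hammingNorm x)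
    (hd' : ∃ x ∈ G, x ∉ traceDual M ∧ hammingNorm x = d)
    (hl : IsLeast {w | ∃ x ∈ M, x ∉ traceDual G ∧ hammingNorm x = w} l) :
    HasMinDistance p (charCode G M) (min d l) := by
  obtain ⟨x, hxG, hxM, hxd⟩ := hd'
  obtain ⟨⟨y, hyM, hyG, hyl⟩, hl⟩ := hl
  refine ⟨lt_min ?_ ?_, fun c a b hw => ?_, ?_⟩
  · rw [← hxd, hammingNorm_pos_iff]
    rintro rfl
    exact hxM (zero_mem _)
  · rw [← hyl, hammingNorm_pos_iff]
    rintro rfl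
    exact hyG (zero_mem _)
  · by_cases ha : a ∈ G
    · by_cases hb : b ∈ M
      · have ha0 : a = 0 := by
          by_contra ha0
          exact absurd ((hd a ha ha0).trans (hammingNorm_le_errorWeight_left (p := p) a b))
            (not_le.2 (hw.trans_le (min_le_left _ _)))
        subst ha0
        refine detects_of_mem_traceDual ?_ c
        by_contra hbG
        exact absurd ((hl ⟨b, hb, hbG, rfl⟩).trans (hammingNorm_le_errorWeight_right (p := p) _ b))
          (not_le.2 (hw.trans_le (min_le_right _ _)))
      · exact detects_of_not_mem_right ha h hb c
    · exact detects_of_not_mem_left ha c b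
  · rcases min_choice d l with h | h <;> rw [h]
    · exact ⟨0, x, 0, by rw [errorWeight_zero_right, hxd], not_detects_X hxG hxM⟩
    · exact ⟨0, 0, y, by rw [errorWeight_zero_left, hyl], not_detects_Z hyM hyG⟩

end CharStates

section Blocks

variable {p : ℕ} [Fact p.Prime] {F K : Type*} [Field F] [Fintype F] [DecidableEq F]
  [Algebra (ZMod p) F] [Field K] [Fintype K] [Algebra (ZMod p) K] {n m : ℕ}

/-! ### Block codes -/

theorem concat_rows {A : Type*} (x : Fin m × Fin n → A) : (concat fun i j => x (i, j)) = x := rfl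

theorem traceDot_prod (x y : Fin m × Fin n → F) :
    traceDot p F (Fin m × Fin n) x y =
      ∑ i, traceDot p F (Fin n) (fun j => x (i, j)) fun j => y (i, j) := by
  simp only [traceDot_apply, dotProduct, Fintype.sum_prod_type, map_sum]

/-- The words all of whose blocks lie in `C`. -/
def blockCode (p : ℕ) [Fact p.Prime] [Algebra (ZMod p) F] (m : ℕ)
    (C : Submodule F (Fin n → F)) : Submodule (ZMod p) (Fin m × Fin n → F) where
  carrier := {x | ∀ i, (fun j => x (i, j)) ∈ C}
  add_mem' hx hy i := C.add_mem (hx i) (hy i)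
  zero_mem' _ := C.zero_mem
  smul_mem' a _ hx i := C.smul_of_tower_mem a (hx i)

/-- The word whose `i`-th block is `c` and whose other blocks vanish. -/
def singleBlock (i : Fin m) (c : Fin n → F) : Fin m × Fin n → F :=
  concat (Pi.single i c)

theorem singleBlock_row (i i' : Fin m) (c : Fin n → F) :
    (fun j => singleBlock i c (i', j)) = if i' = i then c else 0 := by
  funext j
  by_cases h : i' = i
  · subst h; simp [singleBlock, concat]
  · simp [singleBlock, concat, h]

theorem singleBlock_mem {C : Submodule F (Fin n → F)} {c : Fin n → F} (hc : c ∈ C) (i : Fin m) :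
    singleBlock i c ∈ blockCode p m C := fun i' => by
  rw [singleBlock_row]
  split_ifs
  exacts [hc, C.zero_mem]

theorem traceDot_singleBlock (i : Fin m) (c : Fin n → F) (y : Fin m × Fin n → F) :
    traceDot p F _ (singleBlock i c) y = traceDot p F (Fin n) c fun j => y (i, j) := by
  rw [traceDot_prod, Finset.sum_eq_single i]
  · rw [singleBlock_row, if_pos rfl]
  · intro i' _ h
    rw [singleBlock_row, if_neg h, map_zero, LinearMap.zero_apply]
  · simp

theorem hammingNorm_concat (x : Fin m → Fin n → F) :
    hammingNorm (concat x) = ∑ i, hammingNorm (x i) := by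
  refine (Finset.card_filter _ _).trans ((Fintype.sum_prod_type _).trans ?_)
  exact Finset.sum_congr rfl fun i _ => (Finset.card_filter _ _).symm

theorem hammingNorm_row_le (x : Fin m × Fin n → F) (i : Fin m) :
    hammingNorm (fun j => x (i, j)) ≤ hammingNorm x := by
  rw [← concat_rows x, hammingNorm_concat]
  exact Finset.single_le_sum (f := fun i => hammingNorm fun j => x (i, j))
    (fun _ _ => Nat.zero_le _) (Finset.mem_univ i)

theorem hammingNorm_singleBlock (i : Fin m) (c : Fin n → F) :
    hammingNorm (singleBlock i c) = hammingNorm c := by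
  rw [singleBlock, hammingNorm_concat, Finset.sum_eq_single i]
  · simp
  · intro i' _ h
    simp [h]
  · simp

/-- Since `C` is `F`-linear, trace orthogonality to all multiples of a codeword forces the dot
product itself to vanish. -/
theorem mem_traceDual_blockCode {C : Submodule F (Fin n → F)} {x : Fin m × Fin n → F} :
    x ∈ traceDual (blockCode p m C) ↔ ∀ i, (fun j => x (i, j)) ∈ dualCode C := by
  constructor
  · intro hx i c hc
    refine eq_zero_of_trace_mul_eq_zero (p := p) fun b => ?_
    have := mem_traceDual.1 hx _ (singleBlock_mem (C.smul_mem b hc) i)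
    rwa [traceDot_comm, traceDot_singleBlock, traceDot_apply, smul_dotProduct, smul_eq_mul,
      dotProduct_comm] at this
  · intro hx
    refine mem_traceDual.2 fun y hy => ?_
    rw [traceDot_prod]
    refine Finset.sum_eq_zero fun i _ => ?_
    rw [traceDot_apply, hx i _ (hy i), map_zero]

/-! ### The code attached to `D` -/

variable {C : Submodule F (Fin n → F)} (κ : K ≃ₗ[ZMod p] (C →ₗ[ZMod p] ZMod p))
  (D : Submodule K (Fin m → K))

theorem mem_Theta {l : K} {x : Fin n → F} :
    x ∈ Theta κ l ↔ ∀ c : C, κ l c = traceDot p F (Fin n) c x := Iff.rfl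

theorem Theta_nonempty (l : K) : (Theta κ l).Nonempty := by
  obtain ⟨y, hy⟩ := exists_traceDot_eq
    (M := C.restrictScalars (ZMod p)) (κ l)
  exact ⟨y, hy⟩

/-- A representative of the class `Θ(λ_1) × ... × Θ(λ_m)`. -/
def thetaRep (L : Fin m → K) : Fin m × Fin n → F :=
  concat fun i => (Theta_nonempty κ (L i)).some

theorem thetaRep_mem (L : Fin m → K) (i : Fin m) :
    (fun j => thetaRep κ L (i, j)) ∈ Theta κ (L i) :=
  (Theta_nonempty κ (L i)).some_mem

/-- The set `D^Θ` as a space of words. -/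
def thetaCode : Submodule (ZMod p) (Fin m × Fin n → F) where
  carrier := {x | (fun i j => x (i, j)) ∈ DTheta κ D}
  add_mem' := by
    rintro x y ⟨L, hL, hx⟩ ⟨L', hL', hy⟩
    refine ⟨L + L', D.add_mem hL hL', fun i => (mem_Theta κ).2 fun c => ?_⟩
    rw [Pi.add_apply, map_add, LinearMap.add_apply, (mem_Theta κ).1 (hx i), (mem_Theta κ).1 (hy i),
      ← map_add]
    rfl
  zero_mem' := ⟨0, D.zero_mem, fun i => (mem_Theta κ).2 fun c => by
    rw [Pi.zero_apply, map_zero]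
    exact (map_zero (traceDot p F (Fin n) c)).symm⟩
  smul_mem' := by
    rintro a x ⟨L, hL, hx⟩
    refine ⟨a • L, D.smul_of_tower_mem a hL, fun i => (mem_Theta κ).2 fun c => ?_⟩
    rw [Pi.smul_apply, map_smul, LinearMap.smul_apply, (mem_Theta κ).1 (hx i), ← map_smul]
    rfl

variable {D}

theorem thetaRep_mem_thetaCode {L : Fin m → K} (hL : L ∈ D) : thetaRep κ L ∈ thetaCode κ D :=
  ⟨L, hL, thetaRep_mem κ L⟩

/-- `(C^⊥)^m` is the class belonging to `Λ = 0`. -/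
theorem traceDual_blockCode_le : traceDual (blockCode p m C) ≤ thetaCode κ D := fun x hx => by
  refine ⟨0, D.zero_mem, fun i => (mem_Theta κ).2 fun c => ?_⟩
  rw [Pi.zero_apply, map_zero, LinearMap.zero_apply, traceDot_comm, traceDot_apply,
    mem_traceDual_blockCode.1 hx i c c.2, map_zero]

theorem traceDot_concat {L : Fin m → K} {y : Fin m × Fin n → F}
    (hy : ∀ i, (fun j => y (i, j)) ∈ Theta κ (L i)) (c : Fin m → C) :
    traceDot p F _ (concat fun i => (c i : Fin n → F)) y = FL κ L c := by
  simp only [FL, LinearMap.sum_apply, LinearMap.comp_apply, LinearMap.proj_apply]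
  rw [traceDot_prod]
  exact Finset.sum_congr rfl fun i _ => ((mem_Theta κ).1 (hy i) (c i)).symm

theorem mem_traceDual_thetaCode {c : Fin m → C} :
    (concat fun i => (c i : Fin n → F)) ∈ traceDual (thetaCode κ D) ↔
      c ∈ ⨅ L ∈ D, LinearMap.ker (FL κ L) := by
  simp only [Submodule.mem_iInf, LinearMap.mem_ker, mem_traceDual]
  constructor
  · intro h L hL
    rw [← traceDot_concat κ (thetaRep_mem κ L)]
    exact h _ (thetaRep_mem_thetaCode κ hL)
  · rintro h y ⟨L, hL, hy⟩
    rw [traceDot_concat κ hy, h L hL]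

/-- A class modulo `(C^⊥)^m` determines the functionals `f_{λ_i}`, and `κ` is injective. -/
theorem eq_of_sub_mem_traceDual {L L' : Fin m → K} {y y' : Fin m × Fin n → F}
    (hy : ∀ i, (fun j => y (i, j)) ∈ Theta κ (L i))
    (hy' : ∀ i, (fun j => y' (i, j)) ∈ Theta κ (L' i))
    (h : y - y' ∈ traceDual (blockCode p m C)) : L = L' := by
  funext i
  refine κ.injective (LinearMap.ext fun c => ?_)
  rw [(mem_Theta κ).1 (hy i), (mem_Theta κ).1 (hy' i), ← sub_eq_zero, ← map_sub]
  have := mem_traceDual.1 h _ (singleBlock_mem c.2 i)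
  rwa [traceDot_comm, traceDot_singleBlock] at this

theorem phi_apply (l : K) (x : Fin n → F) {y : Fin n → F} (hy : y ∈ Theta κ l) :
    phi (matrixOf p fun l c => κ l c) l x =
      ((1 / Real.sqrt ((Fintype.card F : ℝ) ^ Module.finrank F C) : ℝ) : ℂ) *
        if x ∈ C then (ZMod.stdAddChar (traceDot p F (Fin n) x y) : ℂ) else 0 := by
  rw [phi, finsum_eq_sum_of_fintype, PiLp.smul_apply, smul_eq_mul]
  congr 1
  simp only [WithLp.ofLp_sum, Finset.sum_apply, WithLp.ofLp_smul, Pi.smul_apply, smul_eq_mul,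
    matrixOf, Matrix.of_apply, ket, PiLp.single_apply, mul_ite, mul_one, mul_zero]
  split_ifs with hx
  · rw [Finset.sum_eq_single (⟨x, hx⟩ : C)]
    · rw [if_pos rfl, (mem_Theta κ).1 hy]
    · intro c _ hc
      exact if_neg fun h => hc (Subtype.ext h.symm)
    · simp
  · exact Finset.sum_eq_zero fun c _ => if_neg fun h : x = c => hx (h ▸ c.2)

theorem tensorState_phi {L : Fin m → K} {y : Fin m × Fin n → F}
    (hy : ∀ i, (fun j => y (i, j)) ∈ Theta κ (L i)) :
    (tensorState fun i => phi (matrixOf p fun l c => κ l c) (L i)) =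
      (((1 / Real.sqrt ((Fintype.card F : ℝ) ^ Module.finrank F C) : ℝ) : ℂ) ^ m) •
        charState (blockCode p m C) y := by
  ext x
  simp only [tensorState, PiLp.smul_apply, smul_eq_mul, charState_apply]
  refine (Finset.prod_congr rfl fun i _ => phi_apply κ (L i) (fun j => x (i, j)) (hy i)).trans ?_
  rw [Finset.prod_mul_distrib, Finset.prod_const, Finset.card_univ, Fintype.card_fin, Finset.prod_ite_zero]
  congr 1
  by_cases hx : x ∈ blockCode p m C
  · rw [if_pos hx, if_pos fun i _ => hx i, traceDot_prod]
    exact (map_prod (ZMod.stdAddChar (N := p)).toMonoidHom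
      (fun i => Multiplicative.ofAdd
        (traceDot p F (Fin n) (fun j => x (i, j)) fun j => y (i, j))) _).symm
  · rw [if_neg hx, if_neg fun h => hx fun i => h i (Finset.mem_univ i)]

theorem normalization_ne_zero (C : Submodule F (Fin n → F)) (m : ℕ) :
    ((1 / Real.sqrt ((Fintype.card F : ℝ) ^ Module.finrank F C) : ℝ) : ℂ) ^ m ≠ 0 := by
  have : (0 : ℝ) < Fintype.card F := by exact_mod_cast Fintype.card_pos
  refine pow_ne_zero _ (Complex.ofReal_ne_zero.2 (ne_of_gt ?_))
  positivity

theorem QH_eq_charCode :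
    QH (matrixOf p fun l c => κ l c) D = charCode (blockCode p m C) (thetaCode κ D) := by
  refine le_antisymm (Submodule.span_le.2 ?_) (Submodule.span_le.2 ?_)
  · rintro _ ⟨L, hL, rfl⟩
    rw [tensorState_phi κ (thetaRep_mem κ L)]
    exact Submodule.smul_mem _ _ (charState_mem (thetaRep_mem_thetaCode κ hL))
  · rintro _ ⟨y, ⟨L, hL, hy⟩, rfl⟩
    rw [SetLike.mem_coe, ← Submodule.smul_mem_iff _ (normalization_ne_zero C m),
      ← tensorState_phi κ hy]
    exact Submodule.subset_span ⟨L, hL, rfl⟩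

/-- One representative for each `Λ ∈ D` gives an orthogonal basis: labels over the same `Λ` give the
same state. -/
theorem finrank_charCode_thetaCode :
    Module.finrank ℂ (charCode (blockCode p m C) (thetaCode κ D)) = Fintype.card D := by
  have hli := linearIndependent_charState (G := blockCode p m C)
    (fun L : D => thetaRep κ (L : Fin m → K)) fun L L' h =>
      Subtype.ext (eq_of_sub_mem_traceDual κ (thetaRep_mem κ _) (thetaRep_mem κ _) h)
  rw [← finrank_span_eq_card hli]
  suffices h : charCode (blockCode p m C) (thetaCode κ D) = Submodule.span ℂ (Set.range
      fun L : D => charState (blockCode p m C) (thetaRep κ (L : Fin m → K))) by rw [h]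
  refine le_antisymm (Submodule.span_le.2 ?_) (Submodule.span_le.2 ?_)
  · rintro _ ⟨y, ⟨L, hL, hy⟩, rfl⟩
    refine Submodule.subset_span ⟨⟨L, hL⟩, charState_eq_of_sub_mem ?_⟩
    refine mem_traceDual.2 fun x hx => ?_
    have key : ∀ z : Fin m × Fin n → F, (∀ i, (fun j => z (i, j)) ∈ Theta κ (L i)) →
        traceDot p F _ x z = FL κ L fun i => ⟨_, hx i⟩ := fun z hz =>
      traceDot_concat κ hz fun i => ⟨_, hx i⟩
    rw [traceDot_comm, map_sub, key _ (thetaRep_mem κ L), key y hy, sub_self]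
  · rintro _ ⟨L, rfl⟩
    exact charState_mem (thetaRep_mem_thetaCode κ L.2)

/-! ### The two minima and the minimum distance of the code -/

theorem exists_isLeast {S : Set ℕ} (h : S.Nonempty) : ∃ d, IsLeast S d :=
  ⟨sInf S, Nat.sInf_mem h, fun _ => Nat.sInf_le⟩

theorem exists_isMinDist (hC : C ≠ ⊥) : ∃ d, IsMinDist C d := by
  obtain ⟨x, hx, hx0⟩ := C.exists_mem_ne_zero_of_ne_bot hC
  exact exists_isLeast ⟨_, x, hx, 0, C.zero_mem, hx0, rfl⟩

theorem setOf_weight_thetaCode :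
    {w | ∃ x ∈ thetaCode κ D, x ∉ traceDual (blockCode p m C) ∧ hammingNorm x = w} =
      {w | ∃ x ∈ DTheta κ D, (¬ ∀ i, x i ∈ dualCode C) ∧ hammingNorm (concat x) = w} := by
  ext w
  constructor
  · rintro ⟨x, hx, hx', hw⟩
    exact ⟨fun i j => x (i, j), hx, fun h => hx' (mem_traceDual_blockCode.2 h), hw⟩
  · rintro ⟨x, hx, hx', hw⟩
    exact ⟨concat x, hx, fun h => hx' (mem_traceDual_blockCode.1 h), hw⟩

theorem exists_isLeastWeight (hD : D ≠ ⊥) : ∃ l, IsLeastWeight κ D l := by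
  obtain ⟨L, hL, hL0⟩ := D.exists_mem_ne_zero_of_ne_bot hD
  unfold IsLeastWeight
  rw [← setOf_weight_thetaCode]
  refine exists_isLeast ⟨_, thetaRep κ L, thetaRep_mem_thetaCode κ hL, fun h => hL0 ?_, rfl⟩
  refine eq_of_sub_mem_traceDual κ (y' := 0) (thetaRep_mem κ L) (fun i => ?_) (by simpa using h)
  refine (mem_Theta κ).2 fun c => ?_
  rw [Pi.zero_apply, map_zero]
  exact (map_zero (traceDot p F (Fin n) c)).symm

/-- Some functional separates a nonzero codeword, and `D` is closed under scalars, so a word with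
a single nonzero block in `C` is not killed by all the functionals `F_Λ`. -/
theorem exists_singleBlock_not_mem (hD : D ≠ ⊥) {c : Fin n → F} (hc : c ∈ C) (hc0 : c ≠ 0) :
    ∃ i, singleBlock i c ∉ traceDual (thetaCode κ D) := by
  obtain ⟨L, hL, hL0⟩ := D.exists_mem_ne_zero_of_ne_bot hD
  obtain ⟨i, hi⟩ := Function.ne_iff.1 hL0
  have hc0' : (⟨c, hc⟩ : C) ≠ 0 := fun h => hc0 (congrArg Subtype.val h)
  obtain ⟨f, hf⟩ := not_forall.1 (mt (Module.forall_dual_apply_eq_zero_iff (ZMod p) _).1 hc0')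
  refine ⟨i, fun h => hf ?_⟩
  -- The scalar makes the `i`-th entry equal to `κ.symm f`, so this block is tested by `f` itself.
  have hL' : (κ.symm f / L i) • L ∈ D := D.smul_mem _ hL
  have h1 := mem_traceDual.1 h _ (thetaRep_mem_thetaCode κ hL')
  have h2 := (mem_Theta κ).1 (thetaRep_mem κ ((κ.symm f / L i) • L) i) ⟨c, hc⟩
  rw [traceDot_singleBlock] at h1
  rw [h1, Pi.smul_apply, smul_eq_mul, div_mul_cancel₀ _ hi, LinearEquiv.apply_symm_apply] at h2
  exact h2

theorem hasMinDistance_thetaCode (hD : D ≠ ⊥) {d l : ℕ} (hd : IsMinDist C d)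
    (hl : IsLeastWeight κ D l) :
    HasMinDistance p (charCode (blockCode p m C) (thetaCode κ D)) (min d l) := by
  refine hasMinDistance_charCode (traceDual_blockCode_le κ) (fun x hx hx0 => ?_) ?_ ?_
  · obtain ⟨⟨i, j⟩, hij⟩ := Function.ne_iff.1 hx0
    refine le_trans (hd.2 ⟨_, hx i, 0, C.zero_mem, fun h => hij (congrFun h j), ?_⟩)
      (hammingNorm_row_le x i)
    rw [hammingDist_zero_right]
  · obtain ⟨⟨x, hx, y, hy, hxy, rfl⟩, -⟩ := hd
    -- The difference of two codewords at distance `d`, placed in a suitable block, attains `d`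
    -- outside the dual of `D^Θ`.
    have hc : -x + y ∈ C := C.add_mem (C.neg_mem hx) hy
    obtain ⟨i, hi⟩ := exists_singleBlock_not_mem κ hD hc (mt neg_add_eq_zero.1 hxy)
    refine ⟨_, singleBlock_mem hc i, hi, ?_⟩
    rw [hammingNorm_singleBlock, hammingDist_eq_hammingNorm]
  · rw [setOf_weight_thetaCode]
    exact hl

end Blocks

end

end QCode

theorem mainTheorem1 (p : ℕ) [Fact p.Prime] {F K : Type*} [Field F] [Fintype F] [DecidableEq F]
    [Algebra (ZMod p) F] [Field K] [Fintype K] [Algebra (ZMod p) K] (n m k s : ℕ)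
    (hk : 1 ≤ k) (hs : 1 ≤ s) (hK : Fintype.card K = Fintype.card F ^ k)
    (C : Submodule F (Fin n → F)) (hC : Module.finrank F C = k)
    (D : Submodule K (Fin m → K)) (hD : Module.finrank K D = s)
    (κ : K ≃ₗ[ZMod p] (C →ₗ[ZMod p] ZMod p))
    (Q : Submodule ℂ (QCode.QuditSpace F (Fin m × Fin n)))
    (hQ : Q = QCode.QH (QCode.matrixOf p fun l c => κ l c) D) :
    QCode.IsStabilizerCode p Q ∧
    (∃ d l : ℕ, QCode.IsMinDist C d ∧ QCode.IsLeastWeight κ D l ∧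
      QCode.IsQuantumCode p Q (n * m) (k * s) (min d l)) ∧
    QCode.stab p Q =
      {E | ∃ c : Fin m → C, c ∈ (⨅ L ∈ D, LinearMap.ker (QCode.FL κ L)) ∧
        ∃ d : Fin m → Fin n → F, (∀ i, d i ∈ QCode.dualCode C) ∧
          E = QCode.X (QCode.concat fun i => (c i : Fin n → F)) * QCode.Z p (QCode.concat d)} ∧
    QCode.centralizer p (QCode.stab p Q) =
      {E | ∃ (c : ℕ) (u v : Fin m → Fin n → F), (∀ i, u i ∈ C) ∧ v ∈ QCode.DTheta κ D ∧
        E = QCode.phase p ^ c • (QCode.X (QCode.concat u) * QCode.Z p (QCode.concat v))} := by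
  have hle := QCode.traceDual_blockCode_le (m := m) κ (D := D)
  have hC0 : C ≠ ⊥ := by
    rintro rfl
    rw [finrank_bot] at hC
    omega
  have hD0 : D ≠ ⊥ := by
    rintro rfl
    rw [finrank_bot] at hD
    omega
  obtain ⟨d, hd⟩ := QCode.exists_isMinDist hC0
  obtain ⟨l, hl⟩ := QCode.exists_isLeastWeight κ hD0
  rw [QCode.QH_eq_charCode] at hQ
  subst hQ
  refine ⟨QCode.isStabilizerCode_charCode hle, ⟨d, l, hd, hl, ?_, ?_, ?_⟩, ?_, ?_⟩
  · rw [Fintype.card_prod, Fintype.card_fin, Fintype.card_fin, mul_comm]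
  · classical
    rw [QCode.finrank_charCode_thetaCode, ← Nat.card_eq_fintype_card,
      Module.natCard_eq_pow_finrank (K := K), hD, Nat.card_eq_fintype_card, hK, pow_mul]
  · exact QCode.hasMinDistance_thetaCode κ hD0 hd hl
  · rw [QCode.stab_charCode]
    ext E
    constructor
    · rintro ⟨c, hc, hcG, d, hd, rfl⟩
      exact ⟨fun i => ⟨_, hcG i⟩, (QCode.mem_traceDual_thetaCode κ).1 hc, fun i j => d (i, j),
        QCode.mem_traceDual_blockCode.1 hd, rfl⟩
    · rintro ⟨c, hc, d, hd, rfl⟩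
      exact ⟨_, (QCode.mem_traceDual_thetaCode κ).2 hc, fun i => (c i).2, QCode.concat d,
        QCode.mem_traceDual_blockCode.2 hd, rfl⟩
  · rw [QCode.centralizer_stab_charCode hle]
    ext E
    constructor
    · rintro ⟨c, u, hu, v, hv, rfl⟩
      exact ⟨c, fun i j => u (i, j), fun i j => v (i, j), hu, hv, rfl⟩
    · rintro ⟨c, u, v, hu, hv, rfl⟩
      exact ⟨c, QCode.concat u, hu, QCode.concat v, hv, rfl⟩
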